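/- Let $T$ be an arbitrary complete first-order theory, with no finite models, in a language $L$, let $\bar\kappa$ be a cardinal, and let $\mathcal C\models T$ be a monster model, that is, $\mathcal C$ is $\bar\kappa$-saturated and every partial elementary map between subsets of $\mathcal C$ of size $<\bar\kappa$ extends to an automorphism of $\mathcal C$. Let $A\subseteq\mathcal C$ be small, in the sense that $2^{|T|+|A|}<\bar\kappa$, where $|T|=|L|+\aleph_0$ (if $\bar\kappa>|T|$ is a strong limit cardinal this just says $|A|<\bar\kappa$). Let $\bar a,\bar b\in\mathcal C^n$ be finite tuples of the same length. The following are equivalent. (1) $\mathrm{Lstp}(\bar a/A)=\mathrm{Lstp}(\bar b/A)$; that is, $f(\bar a)=\bar b$ for some $f$ in the subgroup $\mathrm{Autf}_A(\mathcal C)$ of $\mathrm{Aut}(\mathcal C)$ generated by the automorphisms that fix pointwise some elementary submodel $M\preceq\mathcal C$ with $A\subseteq M$ and $|M|<\bar\kappa$. (2) $d_A(\bar a,\bar b)<\infty$, where $d_A(\bar a,\bar b)$ is the least natural number $m\ge 1$ for which there are infinite sequences $I_1,\dots,I_m$ (indexed by $\omega$) of $n$-tuples and $n$-tuples $\bar a=\bar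 a_0,\bar a_1,\dots,\bar a_m=\bar b$ such that $\bar a_{i-1}{}^\frown I_i$ and $\bar a_i{}^\frown I_i$ are both $A$-indiscernible for each $1\le i\le m$, and $d_A(\bar a,\bar b)=\infty$ if there is no such $m$. (3) $E(\bar a,\bar b)$ holds for every equivalence relation $E$ on $\mathcal C^n$ that is $A$-invariant (preserved by every automorphism of $\mathcal C$ fixing $A$ pointwise) and bounded (it has strictly fewer than $\bar\kappa$ classes). -/

import Mathlib

open FirstOrder Cardinal

universe u v w

namespace LascarType

section Basic

variable {L : FirstOrder.Language.{u, v}} {C : Type w} [L.Structure C]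

/-- The group of automorphisms of an `L`-structure, under composition. -/
instance autGroup : Group (C ≃[L] C) where
  mul f g := f.comp g
  mul_assoc _ _ _ := rfl
  one := FirstOrder.Language.Equiv.refl L C
  one_mul _ := rfl
  mul_one _ := rfl
  inv f := f.symm
  inv_mul_cancel f := FirstOrder.Language.Equiv.symm_comp_self f

/-- `φ` is a formula with parameters from `A` (the variables indexed by `A` are the parameters)
and with free variables indexed by `α`; `Holds A φ x` says that `φ` is true of `x` in `C`. -/
def Holds (A : Set C) {α : Type*} (φ : L.Formula (A ⊕ α)) (x : α → C) : Prop :=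
  φ.Realize (Sum.elim (fun c : A => (c : C)) x)

variable (L C) in
/-- `κ`-saturation: for every `B ⊆ C` of cardinality less than `κ`, every finitely satisfiable set
of formulas over `B` in finitely many free variables is realized in `C`. -/
def IsSaturated (κ : Cardinal.{w}) : Prop :=
  ∀ B : Set C, #B < κ → ∀ (n : ℕ) (p : Set (L.Formula (B ⊕ Fin n))),
    (∀ q : Finset (L.Formula (B ⊕ Fin n)), (q : Set (L.Formula (B ⊕ Fin n))) ⊆ p →
      ∃ x : Fin n → C, ∀ φ ∈ q, Holds B φ x) →
    ∃ x : Fin n → C, ∀ φ ∈ p, Holds B φ x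

variable (L C) in
/-- Strong `κ`-homogeneity: every partial elementary map from a subset of `C` of cardinality less
than `κ` into `C` extends to an automorphism of `C`. -/
def IsStronglyHomogeneous (κ : Cardinal.{w}) : Prop :=
  ∀ B : Set C, #B < κ → ∀ f : B → C,
    (∀ φ : L.Formula B, φ.Realize (fun b : B => (b : C)) ↔ φ.Realize f) →
    ∃ σ : C ≃[L] C, ∀ b : B, σ (b : C) = f b

variable (L) in
/-- `Aut_A(C)`: the automorphisms of `C` that fix `A` pointwise. -/
def autFixing (A : Set C) : Set (C ≃[L] C) :=
  {f | ∀ c ∈ A, f c = c}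

variable (L) in
/-- `Autf_A(C)`: the subgroup of `Aut(C)` generated by the automorphisms that fix pointwise some
small (of cardinality less than `κ`) elementary submodel `M` of `C` containing `A`. -/
def autf (κ : Cardinal.{w}) (A : Set C) : Subgroup (C ≃[L] C) :=
  Subgroup.closure {f | ∃ M : L.ElementarySubstructure C,
    #M < κ ∧ A ⊆ (M : Set C) ∧ f ∈ autFixing L (M : Set C)}

variable (L) in
/-- `Lstp(a/A) = Lstp(b/A)`. -/
def SameLstp (κ : Cardinal.{w}) (A : Set C) {n : ℕ} (a b : Fin n → C) : Prop :=
  ∃ f ∈ autf L κ A, (fun i => f (a i)) = b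

variable (L) in
/-- The sequence `s` of `n`-tuples is indiscernible over `A`: any two of its strictly increasing
finite subsequences of the same length have the same type over `A`. -/
def Indiscernible (A : Set C) {n : ℕ} (s : ℕ → Fin n → C) : Prop :=
  ∀ (m : ℕ) (i j : Fin m → ℕ), StrictMono i → StrictMono j →
    ∀ φ : L.Formula (A ⊕ (Fin m × Fin n)),
      Holds A φ (fun p => s (i p.1) p.2) ↔ Holds A φ (fun p => s (j p.1) p.2)

/-- The sequence `a, I 0, I 1, I 2, …`. -/
def prepend {α : Type*} (a : α) (I : ℕ → α) : ℕ → α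
  | 0 => a
  | k + 1 => I k

variable (L) in
/-- There are tuples `a = c 0, c 1, …, c k = b` and infinite sequences `I 0, …, I (k - 1)` such
that both `c i ⌢ I i` and `c (i + 1) ⌢ I i` are `A`-indiscernible for every `i < k`. -/
def IndiscernibleChain (A : Set C) {n : ℕ} (k : ℕ) (a b : Fin n → C) : Prop :=
  ∃ (c : ℕ → Fin n → C) (I : ℕ → ℕ → Fin n → C), c 0 = a ∧ c k = b ∧
    ∀ i < k, Indiscernible L A (prepend (c i) (I i)) ∧
      Indiscernible L A (prepend (c (i + 1)) (I i))

variable (L) in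
/-- `d_A(a, b)`: the least `k ≥ 1` such that `a` and `b` are joined by a chain of length `k`, and
`∞` if there is none. -/
noncomputable def lascarDist (A : Set C) {n : ℕ} (a b : Fin n → C) : ℕ∞ :=
  ⨅ k ∈ {k : ℕ | 1 ≤ k ∧ IndiscernibleChain L A k a b}, (k : ℕ∞)

variable (L) in
/-- `E` is `A`-invariant: it is preserved by all automorphisms of `C` that fix `A` pointwise. -/
def IsInvariant (A : Set C) {n : ℕ} (E : Setoid (Fin n → C)) : Prop :=
  ∀ f ∈ autFixing L A, ∀ x y : Fin n → C, E x y → E (fun i => f (x i)) (fun i => f (y i))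

/-- `E` is bounded: it has strictly less than `κ` many classes. -/
def IsBounded (κ : Cardinal.{w}) {n : ℕ} (E : Setoid (Fin n → C)) : Prop :=
  #(Quotient E) < κ

end Basic

end LascarType

/-! (1) → (2): if `f` fixes a model `M ⊇ A` pointwise, then `a` and `f a` have the same type over
`M`. It is finitely satisfiable in `M`, so it extends to the average type of an ultrafilter
concentrating on `M` (`exists_coheir`). Realizing that average repeatedly over `M`, `a`, `f a` and
the earlier terms gives one sequence that is indiscernible after either tuple
(`indiscernibleChain_one`). Products of generators concatenate chains.

(2) → (3): in each link both end tuples are related to the first term of the common sequence,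
because a bounded invariant `E` relates the first two terms of any `A`-indiscernible sequence
(`Indiscernible.rel_zero_one`). Otherwise the sequence yields `κ` pairwise inequivalent tuples.

(3) → (1): equality of Lascar strong types is itself invariant, and it is bounded because a type
over a model of size `|T| + |A|` determines the class (`isBounded_lascarSetoid`). -/

namespace LascarType

open Filter FirstOrder.Language

/-! ### Average types of ultrafilters and coheirs. -/

section AverageTypes

variable {L : FirstOrder.Language.{u, v}} {C : Type w} [L.Structure C] {n : ℕ}

variable (L) in
/-- `y` realizes over `D` the average type of the ultrafilter `U`. -/
def RealizesAverage (U : Ultrafilter (Fin n → C)) (D : Set C) (y : Fin n → C) : Prop :=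
  ∀ φ : L.Formula (D ⊕ Fin n), Holds D φ y ↔ ∀ᶠ x in U, Holds D φ x

theorem RealizesAverage.realize_iff {U : Ultrafilter (Fin n → C)} {D : Set C} {y : Fin n → C}
    (h : RealizesAverage L U D y) {γ : Type*} (v : γ → C) (hv : ∀ c, v c ∈ D)
    (φ : L.Formula (γ ⊕ Fin n)) :
    φ.Realize (Sum.elim v y) ↔ ∀ᶠ x in U, φ.Realize (Sum.elim v x) := by
  have key : ∀ z : Fin n → C, Holds D (φ.relabel (Sum.map (fun c => ⟨v c, hv c⟩) id)) z ↔
      φ.Realize (Sum.elim v z) := fun z => by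
    rw [Holds, Formula.realize_relabel, Sum.elim_comp_map]; rfl
  simpa only [key] using h (φ.relabel (Sum.map (fun c => ⟨v c, hv c⟩) id))

theorem RealizesAverage.mono {U : Ultrafilter (Fin n → C)} {D D' : Set C} {y : Fin n → C}
    (h : RealizesAverage L U D y) (hD : D' ⊆ D) : RealizesAverage L U D' y :=
  fun φ => h.realize_iff (fun c : D' => (c : C)) (fun c => hD c.2) φ

/-- Finitely many `U`-large sets have a common point, so saturation applies; the converse
implication uses that `U` decides every formula. -/
theorem exists_realizesAverage {κ : Cardinal.{w}} (hsat : IsSaturated L C κ)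
    (U : Ultrafilter (Fin n → C)) {D : Set C} (hD : #D < κ) :
    ∃ y, RealizesAverage L U D y := by
  obtain ⟨y, hy⟩ := hsat D hD n {φ | ∀ᶠ x in U, Holds D φ x} fun q hq =>
    ((Finset.eventually_all q).2 fun φ hφ => hq hφ).exists
  refine ⟨y, fun φ => ⟨fun h => ?_, fun h => hy φ h⟩⟩
  by_contra hn
  rw [← Ultrafilter.eventually_not] at hn
  have := hy φ.not (by simpa [Holds, Formula.realize_not] using hn)
  simp only [Holds, Formula.realize_not] at this h
  exact this h

/-- Realizations of an average type can be iterated along a well-order. -/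
theorem exists_iterated_average {κ : Cardinal.{w}} (hsat : IsSaturated L C κ)
    (U : Ultrafilter (Fin n → C)) {ι : Type*} [LinearOrder ι] [WellFoundedLT ι] (N : Set C)
    (hN : ∀ (c : ι → Fin n → C) (β : ι),
      #(N ∪ ⋃ γ ∈ Set.Iio β, Set.range (c γ) : Set C) < κ) :
    ∃ c : ι → Fin n → C, ∀ β,
      RealizesAverage L U (N ∪ ⋃ γ ∈ Set.Iio β, Set.range (c γ)) (c β) := by
  have hg : ∀ D : Set C, ∃ y, #D < κ → RealizesAverage L U D y := fun D => by
    -- A junk value on large `D` makes `g` total, so the recursion needs no size bound on earlier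
    -- terms.
    by_cases hD : #D < κ
    · obtain ⟨y, hy⟩ := exists_realizesAverage hsat U hD
      exact ⟨y, fun _ => hy⟩
    · obtain ⟨x, -⟩ := (Eventually.of_forall (f := (U : Filter (Fin n → C)))
        fun _ => trivial).exists
      exact ⟨x, fun h => absurd h hD⟩
  choose g hg using hg
  let c : ι → Fin n → C := (wellFounded_lt (α := ι)).fix fun β ih =>
    g (N ∪ ⋃ (γ : ι) (h : γ ∈ Set.Iio β), Set.range (ih γ h))
  refine ⟨c, fun β => ?_⟩
  have hc : c β = g (N ∪ ⋃ γ ∈ Set.Iio β, Set.range (c γ)) := WellFounded.fix_eq _ _ _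
  rw [hc]
  exact hg _ (hN c β)

theorem Indiscernible.mono {A B : Set C} (hAB : A ⊆ B) {s : ℕ → Fin n → C}
    (h : Indiscernible L B s) : Indiscernible L A s := by
  intro m i j hi hj φ
  have key : ∀ z : Fin m × Fin n → C,
      Holds B (φ.relabel (Sum.map (Set.inclusion hAB) id)) z ↔ Holds A φ z := fun z => by
    rw [Holds, Formula.realize_relabel, Sum.elim_comp_map]; rfl
  simpa only [key] using h m i j hi hj (φ.relabel (Sum.map (Set.inclusion hAB) id))

/-- A sequence that iteratedly realizes the average type of an ultrafilter concentrating on tuples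
from `M` is indiscernible over `M`. -/
theorem indiscernible_of_realizesAverage {M : Set C} {U : Ultrafilter (Fin n → C)}
    (hU : ∀ᶠ x : Fin n → C in U, ∀ i, x i ∈ M) {s : ℕ → Fin n → C}
    (hs : ∀ k, RealizesAverage L U (M ∪ ⋃ j ∈ Set.Iio k, Set.range (s j)) (s k)) :
    Indiscernible L M s := by
  intro m
  induction m with
  | zero =>
    intro i j _ _ φ
    rw [Subsingleton.elim i j]
  | succ m ih =>
    intro i j hi hj φ
    let e : M ⊕ (Fin (m + 1) × Fin n) → (M ⊕ (Fin m × Fin n)) ⊕ Fin n :=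
      Sum.elim (fun c => Sum.inl (Sum.inl c)) fun p =>
        Fin.lastCases (motive := fun _ => (M ⊕ (Fin m × Fin n)) ⊕ Fin n) (Sum.inr p.2)
          (fun q => Sum.inl (Sum.inr (q, p.2))) p.1
    have step : ∀ i : Fin (m + 1) → ℕ, StrictMono i →
        (Holds M φ (fun p => s (i p.1) p.2) ↔ ∀ᶠ x in U, (φ.relabel e).Realize
          (Sum.elim (Sum.elim (fun c : M => (c : C))
            (fun p => s (i (Fin.castSucc p.1)) p.2)) x)) := by
      intro i hi
      rw [← (hs (i (Fin.last m))).realize_iff]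
      · rw [Holds, Formula.realize_relabel]
        refine iff_of_eq (congrArg _ (funext ?_))
        rintro (c | ⟨p, q⟩)
        · rfl
        · induction p using Fin.lastCases <;> simp [e]
      · rintro (c | ⟨p, q⟩)
        · exact Or.inl c.2
        · exact Or.inr (Set.mem_biUnion (hi (Fin.castSucc_lt_last p)) ⟨q, rfl⟩)
    rw [step i hi, step j hj]
    -- Almost every `x` lies in `M`, so it can be absorbed into the parameters, leaving `m` tuples
    -- for the induction hypothesis.
    refine eventually_congr (hU.mono fun x hx => ?_)
    have key : ∀ z : Fin m × Fin n → C,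
        Holds M ((φ.relabel e).relabel (Sum.elim id fun q => Sum.inl ⟨x q, hx q⟩)) z ↔
          (φ.relabel e).Realize (Sum.elim (Sum.elim (fun c : M => (c : C)) z) x) := fun z => by
      rw [Holds, Formula.realize_relabel]
      refine iff_of_eq (congrArg _ (funext ?_))
      rintro (c | q) <;> rfl
    rw [← key, ← key]
    exact ih _ _ (fun p q h => hi (Fin.castSucc_lt_castSucc_iff.2 h))
      (fun p q h => hj (Fin.castSucc_lt_castSucc_iff.2 h)) _

/-- Every type over an elementary substructure is finitely satisfiable in it, so it extends to the
average type of an ultrafilter concentrating on tuples from the substructure. -/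
theorem exists_coheir (M : L.ElementarySubstructure C) (a : Fin n → C) :
    ∃ U : Ultrafilter (Fin n → C), (∀ᶠ x : Fin n → C in U, ∀ i, x i ∈ (M : Set C)) ∧
      RealizesAverage L U (M : Set C) a := by
  have hM : ∀ φ : L.Formula ((M : Set C) ⊕ Fin n), Holds (M : Set C) φ a →
      ∃ x : Fin n → C, (∀ i, x i ∈ (M : Set C)) ∧ Holds (M : Set C) φ x := by
    intro φ hφ
    have h1 : (φ.iExs (Fin n)).Realize (M.subtype ∘ id) :=
      Formula.realize_iExs.2 ⟨a, hφ⟩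
    rw [M.subtype.map_formula, Formula.realize_iExs] at h1
    obtain ⟨x, hx⟩ := h1
    rw [← M.subtype.map_formula] at hx
    refine ⟨fun i => x i, fun i => (x i).2, ?_⟩
    rw [Holds]
    convert! hx using 1
    funext i
    cases i <;> rfl
  -- The filter generated by the traces on `M` of the formulas in the type of `a`; it is proper by
  -- `hM`.
  let F : Filter (Fin n → C) :=
    { sets := {S | ∃ φ : L.Formula ((M : Set C) ⊕ Fin n), Holds (M : Set C) φ a ∧
        ∀ x : Fin n → C, (∀ i, x i ∈ (M : Set C)) → Holds (M : Set C) φ x → x ∈ S}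
      univ_sets := ⟨⊤, by simp [Holds, Formula.Realize], fun _ _ _ => trivial⟩
      sets_of_superset := fun ⟨φ, h1, h2⟩ hS => ⟨φ, h1, fun x hx h => hS (h2 x hx h)⟩
      inter_sets := fun ⟨φ, h1, h2⟩ ⟨ψ, h3, h4⟩ =>
        ⟨φ ⊓ ψ, by rw [Holds, Formula.realize_inf]; exact ⟨h1, h3⟩, fun x hx h => by
          rw [Holds, Formula.realize_inf] at h
          exact ⟨h2 x hx h.1, h4 x hx h.2⟩⟩ }
  have hF : F.NeBot := by
    refine ⟨fun h => ?_⟩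
    obtain ⟨φ, h1, h2⟩ : ∅ ∈ F := h ▸ mem_bot
    obtain ⟨x, hx, hφ⟩ := hM φ h1
    exact h2 x hx hφ
  have hle := Ultrafilter.of_le F
  have hφ : ∀ φ : L.Formula ((M : Set C) ⊕ Fin n), Holds (M : Set C) φ a →
      ∀ᶠ x in Ultrafilter.of F, Holds (M : Set C) φ x :=
    fun φ h => hle ⟨φ, h, fun _ _ hx => hx⟩
  refine ⟨Ultrafilter.of F,
    hle ⟨⊤, by simp [Holds, Formula.Realize], fun _ hx _ => hx⟩, fun φ => ⟨hφ φ, fun h => ?_⟩⟩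
  by_contra hn
  have h' := hφ φ.not (by rwa [Holds, Formula.realize_not])
  obtain ⟨x, h1, h2⟩ := (h.and h').exists
  rw [Holds, Formula.realize_not] at h2
  exact h2 h1

end AverageTypes

/-! ### Conjugacy, and the Lascar equivalence relation. -/

section Homogeneity

variable {L : FirstOrder.Language.{u, v}} {C : Type w} [L.Structure C] {n : ℕ}
  {κ : Cardinal.{w}} {A : Set C}

/-- Finite tuples of the same type over a small set are conjugate over it. -/
theorem exists_autFixing_of_holds_iff (hhom : IsStronglyHomogeneous L C κ) (hω : ℵ₀ ≤ κ)
    (hA : #A < κ) {α : Type*} [Finite α] (x y : α → C)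
    (h : ∀ φ : L.Formula (A ⊕ α), Holds A φ x ↔ Holds A φ y) :
    ∃ σ ∈ autFixing L A, ∀ i, σ (x i) = y i := by
  let B : Set C := A ∪ Set.range x
  have hB : #B < κ := (mk_union_le _ _).trans_lt
    (add_lt_of_lt hω hA ((Set.finite_range x).lt_aleph0.trans_le hω))
  let X : A ⊕ α → C := Sum.elim (fun c : A => (c : C)) x
  let Y : A ⊕ α → C := Sum.elim (fun c : A => (c : C)) y
  have hg : ∀ b : B, ∃ p : A ⊕ α, X p = b := by
    rintro ⟨b, hb | ⟨i, rfl⟩⟩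
    · exact ⟨Sum.inl ⟨b, hb⟩, rfl⟩
    · exact ⟨Sum.inr i, rfl⟩
  choose g hg using hg
  -- The enumeration `X` may repeat elements; equality formulas make the induced map independent of
  -- the choice of `g`.
  have hXY : ∀ p q, X p = X q → Y p = Y q := fun p q hpq => by
    have := h ((Term.var p).equal (Term.var q))
    simp only [Holds, Formula.realize_equal, Term.realize_var] at this
    exact this.1 hpq
  obtain ⟨σ, hσ⟩ := hhom B hB (fun b => Y (g b)) fun φ => by
    have := h (φ.relabel g)
    simp only [Holds, Formula.realize_relabel] at this
    rw [show (fun b : B => (b : C)) = X ∘ g from funext fun b => (hg b).symm]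
    exact this
  have hσ' : ∀ p : A ⊕ α, σ (X p) = Y p := fun p => by
    have hp : X p ∈ B := by
      rcases p with c | i
      · exact Or.inl c.2
      · exact Or.inr ⟨i, rfl⟩
    rw [hσ ⟨X p, hp⟩]
    exact hXY _ _ (hg ⟨X p, hp⟩)
  exact ⟨σ, fun c hc => hσ' (Sum.inl ⟨c, hc⟩), fun i => hσ' (Sum.inr i)⟩

/-- Otherwise the formulas `x ≠ c`, for all `c` in `C`, would have a common realization. -/
theorem le_mk_of_isSaturated [Infinite C] (hsat : IsSaturated L C κ) : κ ≤ #C := by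
  by_contra! hlt
  obtain ⟨x, hx⟩ := hsat Set.univ (by rwa [mk_univ]) 1
    (Set.range fun c : C => ((Term.var (Sum.inr 0)).equal (Term.var (Sum.inl ⟨c, trivial⟩))).not)
    fun q hq => by
      classical
      choose! f hf using fun φ (hφ : φ ∈ q) => hq hφ
      obtain ⟨x, hx⟩ := Infinite.exists_notMem_finset (q.image f)
      refine ⟨fun _ => x, fun φ hφ => ?_⟩
      rw [← hf φ hφ, Holds, Formula.realize_not, Formula.realize_equal]
      intro h
      exact hx (Finset.mem_image.2 ⟨φ, hφ, h.symm⟩)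
  have := hx _ ⟨x 0, rfl⟩
  rw [Holds, Formula.realize_not, Formula.realize_equal] at this
  exact this rfl

/-- The image of an elementary substructure under an automorphism. -/
def mapAut (f : C ≃[L] C) (M : L.ElementarySubstructure C) : L.ElementarySubstructure C where
  toSubstructure := (M : L.Substructure C).map f.toEmbedding.toHom
  isElementary' := fun k φ x => by
    let e := f.toEmbedding.substructureEquivMap (M : L.Substructure C)
    obtain ⟨y, rfl⟩ : ∃ y : Fin k → (M : L.Substructure C), x = e ∘ y :=
      ⟨e.symm ∘ x, funext fun i => (e.apply_symm_apply _).symm⟩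
    rw [StrongHomClass.realize_formula e φ, ← M.isElementary' φ y]
    exact StrongHomClass.realize_formula f φ (v := fun i => (y i : C))

theorem coe_mapAut (f : C ≃[L] C) (M : L.ElementarySubstructure C) :
    (mapAut f M : Set C) = f '' (M : Set C) := rfl

/-- If `g` fixes `M` pointwise, the conjugate fixes `f '' M`, a model that still contains `A`
because `f` fixes `A`. -/
theorem conj_mem_autf {f g : C ≃[L] C} (hf : f ∈ autFixing L A) (hg : g ∈ autf L κ A) :
    f * g * f⁻¹ ∈ autf L κ A := by
  induction hg using Subgroup.closure_induction with
  | mem g hg =>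
    obtain ⟨M, hM, hAM, hgM⟩ := hg
    refine Subgroup.subset_closure ⟨mapAut f M, ?_, ?_, ?_⟩
    · exact (mk_image_le (f := f) (s := (M : Set C))).trans_lt hM
    · exact fun c hc => ⟨c, hAM hc, hf c hc⟩
    · rintro _ ⟨c, hc, rfl⟩
      change f (g (f.symm (f c))) = f c
      rw [f.symm_apply_apply, hgM c hc]
  | one => simp
  | mul x y _ _ hx hy => simpa [mul_assoc] using mul_mem hx hy
  | inv x _ hx => simpa [mul_assoc] using inv_mem hx

variable (L n κ A) in
/-- Equality of Lascar strong types over `A`. -/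
def lascarSetoid : Setoid (Fin n → C) where
  r := SameLstp L κ A
  iseqv :=
    { refl := fun _ => ⟨1, one_mem _, rfl⟩
      symm := by
        rintro x _ ⟨f, hf, rfl⟩
        exact ⟨f⁻¹, inv_mem hf, funext fun i => f.symm_apply_apply (x i)⟩
      trans := by
        rintro x _ _ ⟨f, hf, rfl⟩ ⟨g, hg, rfl⟩
        exact ⟨g * f, mul_mem hg hf, rfl⟩ }

theorem isInvariant_lascarSetoid : IsInvariant L A (lascarSetoid L n κ A) := by
  rintro f hf x _ ⟨g, hg, rfl⟩
  refine ⟨f * g * f⁻¹, conj_mem_autf hf hg, funext fun i => ?_⟩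
  change f (g (f.symm (f (x i)))) = f (g (x i))
  rw [f.symm_apply_apply]

/-- Equality of Lascar strong types over `A` has at most as many classes as there are types over
a small elementary substructure containing `A`. -/
theorem isBounded_lascarSetoid (hhom : IsStronglyHomogeneous L C κ) (hω : ℵ₀ ≤ κ)
    (M : L.ElementarySubstructure C) (hM : #M < κ) (hAM : A ⊆ (M : Set C))
    (hcard : 2 ^ (Cardinal.lift.{w} L.card + ℵ₀ + Cardinal.lift.{max u v} #M)
      < Cardinal.lift.{max u v} κ) :
    IsBounded κ (lascarSetoid L n κ A) := by
  let t : Quotient (lascarSetoid L n κ A) → Set (L.Formula ((M : Set C) ⊕ Fin n)) :=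
    fun q => {φ | Holds (M : Set C) φ q.out}
  have ht : Function.Injective t := fun p q hpq => by
    obtain ⟨σ, hσ, hpq⟩ := exists_autFixing_of_holds_iff hhom hω (A := (M : Set C)) hM
      p.out q.out fun φ => Set.ext_iff.1 hpq φ
    rw [← p.out_eq, ← q.out_eq]
    exact Quotient.sound ⟨σ, Subgroup.subset_closure ⟨M, hM, hAM, hσ⟩, funext hpq⟩
  have h1 := mk_le_of_injective (α := ULift.{max u v} _) (ht.comp ULift.down_injective)
  rw [mk_uLift, mk_set] at h1
  have h2 : #(L.Formula ((M : Set C) ⊕ Fin n)) ≤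
      Cardinal.lift.{w} L.card + ℵ₀ + Cardinal.lift.{max u v} #M := by
    refine (mk_le_of_injective (f := fun φ : L.Formula ((M : Set C) ⊕ Fin n) =>
      (⟨0, φ⟩ : Σ k, L.BoundedFormula ((M : Set C) ⊕ Fin n) k)) fun φ ψ h => by
        simpa using h).trans (BoundedFormula.card_le.trans ?_)
    refine max_le (le_add_right le_add_self) ?_
    rw [mk_sum, lift_add, mk_fin]
    simp only [lift_natCast, lift_lift]
    rw [add_comm, add_assoc, add_comm ℵ₀]
    gcongr
    · exact le_rfl
    · exact natCast_le_aleph0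
  rw [IsBounded, ← lift_lt.{w, max u v}]
  exact (h1.trans (power_le_power_left two_ne_zero h2)).trans_lt hcard

end Homogeneity

/-! ### Chains of indiscernible sequences and bounded invariant relations. -/

section Chains

variable {L : FirstOrder.Language.{u, v}} {C : Type w} [L.Structure C] {n : ℕ}
  {κ : Cardinal.{w}} {A : Set C}

theorem IndiscernibleChain.symm {k : ℕ} {a b : Fin n → C} (h : IndiscernibleChain L A k a b) :
    IndiscernibleChain L A k b a := by
  obtain ⟨c, I, h0, hk, h⟩ := h
  refine ⟨fun i => c (k - i), fun i => I (k - 1 - i), by simpa, by simpa, fun i hi => ?_⟩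
  obtain ⟨h1, h2⟩ := h (k - 1 - i) (by omega)
  rw [show k - 1 - i + 1 = k - i by omega] at h2
  beta_reduce
  rw [show k - (i + 1) = k - 1 - i by omega]
  exact ⟨h2, h1⟩

theorem IndiscernibleChain.trans {k l : ℕ} {a b d : Fin n → C}
    (h : IndiscernibleChain L A k a b) (h' : IndiscernibleChain L A l b d) :
    IndiscernibleChain L A (k + l) a d := by
  obtain ⟨c, I, h0, hk, h⟩ := h
  obtain ⟨c', I', h0', hl, h'⟩ := h'
  refine ⟨fun i => if i ≤ k then c i else c' (i - k),
    fun i => if i < k then I i else I' (i - k), by simpa, ?_, fun i hi => ?_⟩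
  · rcases Nat.eq_zero_or_pos l with rfl | hpos
    · simp [hk, ← hl, h0']
    · simp [hl, show ¬ k + l ≤ k by omega]
  · by_cases hik : i < k
    · simpa [hik, hik.le, show i + 1 ≤ k by omega] using h i hik
    -- At the junction `i = k` both branches give the middle tuple.
    · have hc : (if i ≤ k then c i else c' (i - k)) = c' (i - k) := by
        split_ifs with hle
        · obtain rfl : i = k := by omega
          simp [hk, h0']
        · rfl
      have := h' (i - k) (by omega)
      rw [show i - k + 1 = i + 1 - k by omega] at this
      simp only [hc, hik, if_false, show ¬ i + 1 ≤ k by omega]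
      exact this

/-- Tuples conjugate over a small elementary substructure are at distance one. -/
theorem indiscernibleChain_one (hsat : IsSaturated L C κ) (hω : ℵ₀ ≤ κ)
    (M : L.ElementarySubstructure C) (hM : #M < κ) (hAM : A ⊆ (M : Set C))
    {f : C ≃[L] C} (hf : f ∈ autFixing L (M : Set C)) (a : Fin n → C) :
    IndiscernibleChain L A 1 a (fun i => f (a i)) := by
  obtain ⟨U, hU, ha⟩ := exists_coheir M a
  have hb : RealizesAverage L U (M : Set C) (fun i => f (a i)) := fun φ => by
    rw [← ha φ, Holds, Holds, ← StrongHomClass.realize_formula f φ (v := Sum.elim _ a)]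
    refine iff_of_eq (congrArg _ (funext ?_))
    rintro (c | i)
    · exact (hf c c.2).symm
    · rfl
  have hfin : ∀ x : Fin n → C, #(Set.range x) < κ := fun x =>
    (Set.finite_range x).lt_aleph0.trans_le hω
  -- Both tuples are put into the base, so that the same `I` serves for each.
  obtain ⟨I, hI⟩ := exists_iterated_average hsat U (ι := ℕ)
    ((M : Set C) ∪ (Set.range a ∪ Set.range fun i => f (a i))) fun c k => by
      refine (mk_union_le _ _).trans_lt (add_lt_of_lt hω ?_ ?_)
      · exact (mk_union_le _ _).trans_lt (add_lt_of_lt hω hM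
          ((mk_union_le _ _).trans_lt (add_lt_of_lt hω (hfin _) (hfin _))))
      · exact ((Set.finite_Iio k).biUnion fun j _ => Set.finite_range (c j)).lt_aleph0.trans_le hω
  have key : ∀ x : Fin n → C, RealizesAverage L U (M : Set C) x →
      Set.range x ⊆ Set.range a ∪ (Set.range fun i => f (a i)) →
      Indiscernible L A (prepend x I) := by
    intro x hx hsub
    refine (indiscernible_of_realizesAverage hU fun k => ?_).mono hAM
    rcases k with _ | k
    · refine hx.mono (Set.union_subset subset_rfl ?_)
      simp
    · refine (hI k).mono (Set.union_subset (fun c hc => Or.inl (Or.inl hc)) ?_)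
      refine Set.iUnion₂_subset fun j hj => ?_
      rcases j with _ | j
      · exact fun c hc => Or.inl (Or.inr (hsub hc))
      · exact fun c hc => Or.inr (Set.mem_biUnion (Nat.lt_of_succ_lt_succ hj) hc)
  refine ⟨fun i => if i = 0 then a else fun i => f (a i), fun _ => I, rfl, rfl, fun i hi => ?_⟩
  obtain rfl : i = 0 := by omega
  exact ⟨key _ ha Set.subset_union_left, key _ hb Set.subset_union_right⟩

theorem exists_indiscernibleChain (hsat : IsSaturated L C κ) (hω : ℵ₀ ≤ κ)
    (M : L.ElementarySubstructure C) (hM : #M < κ) (hAM : A ⊆ (M : Set C))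
    {f : C ≃[L] C} (hf : f ∈ autf L κ A) (a : Fin n → C) :
    ∃ k, 1 ≤ k ∧ IndiscernibleChain L A k a (fun i => f (a i)) := by
  induction hf using Subgroup.closure_induction generalizing a with
  | mem f hf =>
    obtain ⟨N, hN, hAN, hf⟩ := hf
    exact ⟨1, le_rfl, indiscernibleChain_one hsat hω N hN hAN hf a⟩
  | one =>
    -- Length zero is excluded, so even the identity needs a genuine link, supplied by `M`.
    exact ⟨1, le_rfl, indiscernibleChain_one hsat hω M hM hAM (f := 1) (fun _ _ => rfl) a⟩
  | mul f g _ _ hf hg =>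
    obtain ⟨k, hk, h⟩ := hg a
    obtain ⟨l, -, h'⟩ := hf fun i => g (a i)
    exact ⟨k + l, by omega, h.trans h'⟩
  | inv f _ hf =>
    obtain ⟨k, hk, h⟩ := hf fun i => f.symm (a i)
    simp only [FirstOrder.Language.Equiv.apply_symm_apply] at h
    exact ⟨k, hk, h.symm⟩

/-- The first two terms of an indiscernible sequence are related by every bounded invariant
equivalence relation. -/
theorem Indiscernible.rel_zero_one (hsat : IsSaturated L C κ)
    (hhom : IsStronglyHomogeneous L C κ) (hω : ℵ₀ < κ) (hA : #A < κ)
    {s : ℕ → Fin n → C} (hs : Indiscernible L A s) {E : Setoid (Fin n → C)}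
    (hE : IsInvariant L A E) (hb : IsBounded κ E) : E (s 0) (s 1) := by
  by_contra hne
  let U : Ultrafilter (Fin n → C) := (hyperfilter ℕ).map s
  let N : Set C := A ∪ ⋃ j, Set.range (s j)
  have hN : #N < κ := (mk_union_le _ _).trans_lt (add_lt_of_lt hω.le hA
    ((Set.countable_iUnion fun j => Set.countable_range (s j)).le_aleph0.trans_lt hω))
  obtain ⟨c, hc⟩ := exists_iterated_average hsat U (ι := κ.ord.ToType) N fun c β => by
    refine (mk_union_le _ _).trans_lt (add_lt_of_lt hω.le hN ?_)
    have hsurj : (⋃ γ ∈ Set.Iio β, Set.range (c γ)) ⊆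
        Set.range fun p : Set.Iio β × Fin n => c p.1 p.2 :=
      Set.iUnion₂_subset fun γ hγ => by
        rintro _ ⟨i, rfl⟩
        exact ⟨(⟨γ, hγ⟩, i), rfl⟩
    refine (mk_le_mk_of_subset hsurj).trans_lt (mk_range_le.trans_lt ?_)
    rw [mk_prod, mk_fin]
    rw [lift_uzero, lift_natCast]
    exact mul_lt_of_lt hω.le (by simpa using mk_Iio_lt β (by simp)) ((natCast_lt_aleph0).trans hω)
  -- The order is reversed: for `γ < β`, first `c β` is replaced by some `s j`, then `c γ` by `s i`
  -- with `i` large compared to `j`. Hence `(c γ, c β)` has the type of `(s 1, s 0)`.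
  have hpair : ∀ i j : ℕ, i < j → ∀ φ : L.Formula (A ⊕ (Fin 2 × Fin n)),
      Holds A φ (fun p => ![s j, s i] p.1 p.2) ↔ Holds A φ (fun p => ![s 1, s 0] p.1 p.2) := by
    intro i j hij φ
    have key : ∀ i j : ℕ,
        Holds A (φ.relabel (Sum.map id (Prod.map Fin.rev id))) (fun p => s (![i, j] p.1) p.2) ↔
          Holds A φ (fun p => ![s j, s i] p.1 p.2) := fun i j => by
      rw [Holds, Formula.realize_relabel]
      refine iff_of_eq (congrArg _ (funext ?_))
      rintro (c | ⟨p, q⟩)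
      · rfl
      · fin_cases p <;> rfl
    rw [← key, ← key]
    refine hs 2 _ _ ?_ ?_ _
    · rw [Fin.strictMono_iff_lt_succ]; intro p; fin_cases p; simpa
    · rw [Fin.strictMono_iff_lt_succ]; intro p; fin_cases p; simp
  have hcc : ∀ γ β : κ.ord.ToType, γ < β → ∀ φ : L.Formula (A ⊕ (Fin 2 × Fin n)),
      Holds A φ (fun p => ![s 1, s 0] p.1 p.2) ↔ Holds A φ (fun p => ![c γ, c β] p.1 p.2) := by
    intro γ β hγβ φ
    let e : A ⊕ (Fin 2 × Fin n) → (A ⊕ Fin n) ⊕ Fin n :=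
      Sum.elim (fun c => Sum.inl (Sum.inl c))
        fun p => if p.1 = 0 then Sum.inl (Sum.inr p.2) else Sum.inr p.2
    -- Swaps the two tuples, so that the average can also be taken in the first one.
    let e' : (A ⊕ Fin n) ⊕ Fin n → (A ⊕ Fin n) ⊕ Fin n :=
      Sum.elim (Sum.elim (fun c => Sum.inl (Sum.inl c)) Sum.inr) (fun i => Sum.inl (Sum.inr i))
    have he : ∀ x y : Fin n → C, (φ.relabel e).Realize
        (Sum.elim (Sum.elim (fun c : A => (c : C)) x) y) ↔
          Holds A φ (fun p => ![x, y] p.1 p.2) := fun x y => by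
      rw [Holds, Formula.realize_relabel]
      refine iff_of_eq (congrArg _ (funext ?_))
      rintro (c | ⟨p, q⟩)
      · rfl
      · fin_cases p <;> rfl
    have he' : ∀ x y : Fin n → C, ((φ.relabel e).relabel e').Realize
        (Sum.elim (Sum.elim (fun c : A => (c : C)) y) x) ↔
          Holds A φ (fun p => ![x, y] p.1 p.2) := fun x y => by
      rw [Formula.realize_relabel, ← he]
      refine iff_of_eq (congrArg _ (funext ?_))
      rintro ((c | q) | q) <;> rfl
    have hlarge : ∀ i : ℕ, ∀ᶠ j in (hyperfilter ℕ : Filter ℕ), i < j := fun i =>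
      Nat.hyperfilter_le_atTop (eventually_gt_atTop i)
    have h1 := (hc β).realize_iff (Sum.elim (fun c : A => (c : C)) (c γ))
      (by
        rintro (d | q)
        · exact Or.inl (Or.inl d.2)
        · exact Or.inr (Set.mem_biUnion hγβ ⟨q, rfl⟩)) (φ.relabel e)
    have h2 : ∀ j : ℕ, Holds A φ (fun p => ![c γ, s j] p.1 p.2) ↔
        Holds A φ (fun p => ![s 1, s 0] p.1 p.2) := fun j => by
      rw [← he', (hc γ).realize_iff]
      · simp only [he']
        change (∀ᶠ i in (hyperfilter ℕ : Filter ℕ), Holds A φ fun p => ![s i, s j] p.1 p.2) ↔ _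
        rw [eventually_congr ((hlarge j).mono fun i hi => hpair j i hi φ), eventually_const]
      · rintro (d | q)
        · exact Or.inl (Or.inl d.2)
        · exact Or.inl (Or.inr (Set.mem_iUnion.2 ⟨j, q, rfl⟩))
    rw [← he (c γ), h1]
    simp only [he]
    change _ ↔ ∀ᶠ j in (hyperfilter ℕ : Filter ℕ), Holds A φ fun p => ![c γ, s j] p.1 p.2
    simp only [h2, eventually_const]
  have hnot : ∀ γ β : κ.ord.ToType, γ < β → ¬ E (c γ) (c β) := by
    intro γ β hγβ h
    obtain ⟨σ, hσ, hσ'⟩ := exists_autFixing_of_holds_iff hhom hω.le hA _ _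
      fun φ => (hcc γ β hγβ φ).symm
    have h3 := hE σ hσ _ _ h
    rw [show (fun i => σ (c γ i)) = s 1 from funext fun i => hσ' (0, i),
      show (fun i => σ (c β i)) = s 0 from funext fun i => hσ' (1, i)] at h3
    exact hne (E.symm h3)
  have hinj : Function.Injective fun γ => (Quotient.mk E (c γ)) := fun γ β h => by
    by_contra hγβ
    rcases lt_or_gt_of_ne hγβ with hlt | hlt
    · exact hnot _ _ hlt (Quotient.exact h)
    · exact hnot _ _ hlt (Quotient.exact h.symm)
  have := mk_le_of_injective hinj
  rw [mk_ord_toType] at this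
  exact this.not_gt hb

theorem IndiscernibleChain.rel (hsat : IsSaturated L C κ)
    (hhom : IsStronglyHomogeneous L C κ) (hω : ℵ₀ < κ) (hA : #A < κ) {k : ℕ} {a b : Fin n → C}
    (h : IndiscernibleChain L A k a b) {E : Setoid (Fin n → C)}
    (hE : IsInvariant L A E) (hb : IsBounded κ E) : E a b := by
  obtain ⟨c, I, rfl, rfl, h⟩ := h
  induction k with
  | zero => exact E.refl _
  | succ k ih =>
    refine E.trans (ih fun i hi => h i (by omega)) ?_
    obtain ⟨h1, h2⟩ := h k (by omega)
    exact E.trans (h1.rel_zero_one hsat hhom hω hA hE hb)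
      (E.symm (h2.rel_zero_one hsat hhom hω hA hE hb))

theorem lascarDist_lt_top_iff {a b : Fin n → C} :
    lascarDist L A a b < ⊤ ↔ ∃ k, 1 ≤ k ∧ IndiscernibleChain L A k a b := by
  simp [lascarDist, iInf_lt_iff]

end Chains

end LascarType

theorem proposition11 {L : FirstOrder.Language.{u, v}} (T : L.Theory) (hT : T.IsComplete)
    {C : Type w} [L.Structure C] [Infinite C] (hC : C ⊨ T)
    (κ : Cardinal.{w}) (hsat : LascarType.IsSaturated L C κ)
    (hhom : LascarType.IsStronglyHomogeneous L C κ)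
    (A : Set C)
    (hκ : 2 ^ (Cardinal.lift.{w} L.card + ℵ₀ + Cardinal.lift.{max u v} #A)
      < Cardinal.lift.{max u v} κ)
    {n : ℕ} (a b : Fin n → C) :
    List.TFAE [
      LascarType.SameLstp L κ A a b,
      LascarType.lascarDist L A a b < ⊤,
      ∀ E : Setoid (Fin n → C), LascarType.IsInvariant L A E → LascarType.IsBounded κ E → E a b] :=
  by
  set μ := Cardinal.lift.{w} L.card + ℵ₀ + Cardinal.lift.{max u v} #A
  have hωμ : ℵ₀ ≤ μ := le_add_right le_add_self
  have hLμ : Cardinal.lift.{w} L.card ≤ μ := le_add_right le_self_add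
  have hAμ : Cardinal.lift.{max u v} #A ≤ μ := le_add_self
  have hμκ : μ < Cardinal.lift.{max u v} κ := (cantor μ).trans hκ
  have hω : ℵ₀ < κ := by
    rw [← lift_lt.{w, max u v}, lift_aleph0]
    exact hωμ.trans_lt hμκ
  have hA : #A < κ := lift_lt.1 (hAμ.trans_lt hμκ)
  -- Downward Löwenheim–Skolem: a model of size exactly `μ` has at most `2 ^ μ < κ` types over it.
  obtain ⟨M, hAM, hM⟩ := Language.exists_elementarySubstructure_card_eq L A μ hωμ
    (by rwa [lift_umax.{w, max u v}, lift_id'.{w, max u v}])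
    (by rwa [lift_umax.{max u v, w}, lift_id'.{max u v, w}])
    (by rw [lift_umax.{w, max u v}, lift_id'.{w, max u v}]
        exact hμκ.le.trans (lift_le.2 (LascarType.le_mk_of_isSaturated hsat)))
  have hM' : Cardinal.lift.{max u v} #M = μ := by
    rwa [lift_umax.{w, max u v}, lift_id'.{w, max u v}] at hM
  have hMκ : #M < κ := lift_lt.1 (hM'.trans_lt hμκ)
  have hbdd := LascarType.isBounded_lascarSetoid (n := n) hhom hω.le M hMκ hAM (by
    rwa [hM', add_eq_right hωμ (add_le_of_le hωμ hLμ hωμ)])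
  rw [LascarType.lascarDist_lt_top_iff]
  tfae_have 1 → 2 := by
    rintro ⟨f, hf, rfl⟩
    exact LascarType.exists_indiscernibleChain hsat hω.le M hMκ hAM hf a
  tfae_have 2 → 3 := by
    rintro ⟨k, -, h⟩ E hE hb
    exact h.rel hsat hhom hω hA hE hb
  tfae_have 3 → 1 := fun h => h _ LascarType.isInvariant_lascarSetoid hbdd
  tfae_finish
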